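/- An \emph{mm-space} is a complete separable metric space $X=(X,d_X)$ with a Borel probability measure $\mu_X$ of full support. $\mathrm{Aut}(X)$ is the group of $\mu_X$-preserving isometries of $X$ onto itself; a subgroup is called closed if it is closed for the Ky Fan metric $d_{KF}(f,g)=\inf\{\varepsilon\ge 0 : \mu_X(d_X(f,g)>\varepsilon)\le\varepsilon\}$. Let $\mathcal X$ be the set of mm-isomorphism classes of mm-spaces (an mm-isomorphism is a measure-preserving isometry of one space onto the other), and let $\mathcal X_{\rm eq}$ be the set of classes of pairs $(X,G)$ with $X$ an mm-space and $G\subset\mathrm{Aut}(X)$ a closed subgroup, where $(X,G)\cong(Y,H)$ if some mm-isomorphism $X\to Y$ is equivariant for some group isomorphism $G\to H$. For mm-spaces $X,Y$, subgroups $G\subset\mathrm{Aut}(X)$, $H\subset\mathrm{Aut}(Y)$, and a coupling $\pi$ of $\mu_X$ and $\mu_Y$, put for $g\in G$, $h\in H$ \[ d^\pi(g,h)=\inf_S\max\Bigl\{1-\pi(S),\ \sup_{(x_1,y_1),(x_2,y_2)\in S}|d_X(g(x_1),x_2)-d_Y(h(y_1),y_2)|\Bigr\}, \] where $S$ runs over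 the closed subsets of $\mathrm{supp}\,\pi$ (the supremum being $0$ for $S=\emptyset$). Let $\square^\pi((X,G),(Y,H))$ be the Hausdorff distance between $G$ and $H$ with respect to $d^\pi$, and define the equivariant box distance $\square((X,G),(Y,H))=\inf_\pi\square^\pi((X,G),(Y,H))$ over all couplings $\pi$, and the box distance $\square(X,Y)=\square((X,\{\mathrm{id}_X\}),(Y,\{\mathrm{id}_Y\}))$. Give $\mathcal X_{\rm eq}$ and $\mathcal X$ the topologies of these distances (a set is open if it contains a ball of positive radius around each of its points). \textbf{Theorem.} The projection $\mathcal X_{\rm eq}\to\mathcal X$, $(X,G)\mapsto X$, is a proper map (it is continuous, closed, and has compact fibres). Moreover, if $(X_n,G_n)$, $n=1,2,\dots$, are pairs of an mm-space and a closed subgroup $G_n\subset\mathrm{Aut}(X_n)$, $Y$ is an mm-space, and $\square(X_n,Y)\to0$, then there are a closed subgroup $H\subset\mathrm{Aut}(Y)$ and a subsequence $n_1<n_2<\cdots$ such that $\square((X_{n_k},G_{n_k}),(Y,H))\to0$ as $k\to\infty$. -/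

import Mathlib

open MeasureTheory Filter Topology
open scoped ENNReal

universe u

/-- An mm-space: a complete separable metric space with a fully supported Borel probability
measure. -/
structure MMSpace : Type (u + 1) where
  carrier : Type u
  [metric : MetricSpace carrier]
  [complete : CompleteSpace carrier]
  [separable : TopologicalSpace.SeparableSpace carrier]
  [measurable : MeasurableSpace carrier]
  [borel : BorelSpace carrier]
  μ : Measure carrier
  [prob : IsProbabilityMeasure μ]
  [fullSupport : μ.IsOpenPosMeasure]

namespace MMSpace

instance : CoeSort MMSpace.{u} (Type u) := ⟨MMSpace.carrier⟩

attribute [instance] metric complete separable measurable borel prob fullSupport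

instance (X : MMSpace.{u}) : SecondCountableTopology X :=
  UniformSpace.secondCountable_of_separable X

/-- The group of measure preserving isometries of an mm-space. -/
def Aut (X : MMSpace.{u}) : Subgroup (X ≃ᵢ X) where
  carrier := {f | MeasurePreserving f X.μ X.μ}
  mul_mem' := fun {f _} (hf : MeasurePreserving f X.μ X.μ) hg => hf.comp hg
  one_mem' := MeasurePreserving.id X.μ
  inv_mem' := fun {f} hf =>
    MeasurePreserving.symm f.toHomeomorph.toMeasurableEquiv hf

/-- An mm-isomorphism: a measure preserving isometry of `X` onto `Y`. -/
def IsMMIso {X Y : MMSpace.{u}} (f : X ≃ᵢ Y) : Prop := MeasurePreserving f X.μ Y.μ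

theorem IsMMIso.symm {X Y : MMSpace.{u}} {f : X ≃ᵢ Y} (hf : IsMMIso f) : IsMMIso f.symm :=
  MeasurePreserving.symm f.toHomeomorph.toMeasurableEquiv hf

/-- The couplings (transport plans) between the measures of `X` and `Y`. -/
def Couplings (X Y : MMSpace.{u}) : Set (Measure (X × Y)) :=
  {π | π.map Prod.fst = X.μ ∧ π.map Prod.snd = Y.μ}

/-- The Ky Fan distance `inf {ε ≥ 0 | μ {x | d (f x) (g x) > ε} ≤ ε}` between two maps. -/
noncomputable def kyFan (X : MMSpace.{u}) (f g : X → X) : ℝ≥0∞ :=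
  sInf {ε : ℝ≥0∞ | X.μ {x | ε < edist (f x) (g x)} ≤ ε}

end MMSpace

/-- The topology of a distance function: a set is open when it contains a ball around each of
its points. -/
abbrev distTopology {α : Type*} (d : α → α → ℝ≥0∞) : TopologicalSpace α where
  IsOpen U := ∀ x ∈ U, ∃ ε > 0, ∀ y, d x y < ε → y ∈ U
  isOpen_univ := fun _ _ => ⟨1, one_pos, fun _ _ => trivial⟩
  isOpen_inter := fun _ _ hU hV x hx => by
    obtain ⟨a, ha, hUa⟩ := hU x hx.1
    obtain ⟨b, hb, hVb⟩ := hV x hx.2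
    exact ⟨min a b, lt_min ha hb, fun y hy =>
      ⟨hUa y (hy.trans_le (min_le_left _ _)), hVb y (hy.trans_le (min_le_right _ _))⟩⟩
  isOpen_sUnion := fun _ hs x ⟨U, hU, hx⟩ => by
    obtain ⟨a, ha, h⟩ := hs U hU x hx
    exact ⟨a, ha, fun y hy => ⟨U, hU, h y hy⟩⟩

namespace MMSpace

/-- Closedness of a subgroup of `Aut X` for the topology of the Ky Fan distance. -/
def IsClosedSubgroup (X : MMSpace.{u}) (G : Subgroup X.Aut) : Prop :=
  IsClosed[distTopology fun f g : X.Aut => X.kyFan f.1 g.1] (G : Set X.Aut)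

section Box

variable {X Y : MMSpace.{u}}

/-- The function `f_γ` on pairs of points of `X × Y`, for a self-map `γ` of `X` or of `Y`. -/
noncomputable def displacement : (X → X) ⊕ (Y → Y) → X × Y → X × Y → ℝ
  | Sum.inl g, p, q => dist (g p.1) q.1
  | Sum.inr h, p, q => dist (h p.2) q.2

/-- `d^S`, the supremum over `S × S` of `|f_γ₁ - f_γ₂|` (it is `0` for `S = ∅`). -/
noncomputable def distOn (S : Set (X × Y)) (γ₁ γ₂ : (X → X) ⊕ (Y → Y)) : ℝ≥0∞ :=
  ⨆ p ∈ S, ⨆ q ∈ S, ENNReal.ofReal |displacement γ₁ p q - displacement γ₂ p q|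

/-- `d^π`, the infimum of `max {1 - π(S), d^S}` over the closed subsets `S` of the support
of `π`. -/
noncomputable def distPlan (π : Measure (X × Y)) (γ₁ γ₂ : (X → X) ⊕ (Y → Y)) : ℝ≥0∞ :=
  ⨅ (S : Set (X × Y)) (_ : IsClosed S) (_ : S ⊆ π.support), max (1 - π S) (distOn S γ₁ γ₂)

/-- The Hausdorff distance between `G` and `H` with respect to `d^π`. -/
noncomputable def boxPlan (π : Measure (X × Y)) (G : Subgroup X.Aut) (H : Subgroup Y.Aut) :
    ℝ≥0∞ :=
  max (⨆ g : G, ⨅ h : H, distPlan π (Sum.inl g.1.1) (Sum.inr h.1.1))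
    (⨆ h : H, ⨅ g : G, distPlan π (Sum.inl g.1.1) (Sum.inr h.1.1))

end Box

/-- The equivariant box distance between `(X, G)` and `(Y, H)`. -/
noncomputable def eqBox (X : MMSpace.{u}) (G : Subgroup X.Aut) (Y : MMSpace.{u})
    (H : Subgroup Y.Aut) : ℝ≥0∞ :=
  ⨅ π ∈ Couplings X Y, boxPlan π G H

/-- The box distance between mm-spaces, i.e. the equivariant one for the trivial groups. -/
noncomputable def box (X Y : MMSpace.{u}) : ℝ≥0∞ := eqBox X ⊥ Y ⊥

/-- `f` is an mm-isomorphism, equivariant for the group isomorphism `θ`. -/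
def IsEqIso {X Y : MMSpace.{u}} {G : Subgroup X.Aut} {H : Subgroup Y.Aut}
    (f : X ≃ᵢ Y) (θ : G ≃* H) : Prop :=
  IsMMIso f ∧ ∀ (g : G) (x : X), f (g.1.1 x) = (θ g).1.1 (f x)

section Invariance

variable {X Y X' Y' : MMSpace.{u}}

theorem IsEqIso.symm {G : Subgroup X.Aut} {H : Subgroup Y.Aut} {f : X ≃ᵢ Y} {θ : G ≃* H}
    (h : IsEqIso f θ) : IsEqIso f.symm θ.symm := by
  refine ⟨h.1.symm, fun g y => ?_⟩
  apply f.injective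
  rw [h.2]
  simp

theorem distPlan_map_le (f : X ≃ᵢ X') (e : Y ≃ᵢ Y') (π : Measure (X × Y))
    (g : X → X) (h : Y → Y) (g' : X' → X') (h' : Y' → Y')
    (hg : ∀ x, f (g x) = g' (f x)) (hh : ∀ y, e (h y) = h' (e y)) :
    distPlan (π.map (Prod.map f e)) (Sum.inl g') (Sum.inr h')
      ≤ distPlan π (Sum.inl g) (Sum.inr h) := by
  let F : X × Y ≃ₜ X' × Y' := f.toHomeomorph.prodCongr e.toHomeomorph
  have hF : (Prod.map f e : X × Y → X' × Y') = F := rfl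
  have hap : ∀ T : Set (X' × Y'), π.map (Prod.map f e) T = π (F ⁻¹' T) := fun T => by
    rw [hF]; exact F.toMeasurableEquiv.map_apply T
  refine le_iInf fun S => le_iInf fun hS => le_iInf fun hsub => ?_
  refine (iInf_le _ (F '' S)).trans ((iInf_le _ (F.isClosedMap _ hS)).trans
    ((iInf_le _ ?_).trans (max_le_max ?_ ?_)))
  · rintro _ ⟨p, hp, rfl⟩
    rw [Measure.mem_support_iff_forall]
    intro U hU
    rw [hap]
    exact (Measure.mem_support_iff_forall p).1 (hsub hp) _ (F.continuous.continuousAt hU)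
  · rw [hap, F.preimage_image]
  · refine iSup₂_le ?_
    rintro _ ⟨p, hp, rfl⟩
    refine iSup₂_le ?_
    rintro _ ⟨q, hq, rfl⟩
    refine le_trans (le_of_eq ?_) ((le_iSup₂ q hq).trans (le_iSup₂ (f := fun p _ =>
      ⨆ q ∈ S, ENNReal.ofReal |displacement (Sum.inl g) p q - displacement (Sum.inr h) p q|)
      p hp))
    change ENNReal.ofReal |dist (g' (f p.1)) (f q.1) - dist (h' (e p.2)) (e q.2)| = _
    rw [← hg, ← hh, f.dist_eq, e.dist_eq]
    rfl

theorem map_mem_couplings {f : X ≃ᵢ X'} {e : Y ≃ᵢ Y'} (hf : IsMMIso f) (he : IsMMIso e)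
    {π : Measure (X × Y)} (hπ : π ∈ Couplings X Y) :
    π.map (Prod.map f e) ∈ Couplings X' Y' := by
  have hm : Measurable (Prod.map f e : X × Y → X' × Y') :=
    hf.measurable.prodMap he.measurable
  refine ⟨?_, ?_⟩
  · rw [Measure.map_map measurable_fst hm, ← hf.map_eq, ← hπ.1,
      Measure.map_map hf.measurable measurable_fst]
    rfl
  · rw [Measure.map_map measurable_snd hm, ← he.map_eq, ← hπ.2,
      Measure.map_map he.measurable measurable_snd]
    rfl

theorem eqBox_le {G : Subgroup X.Aut} {H : Subgroup Y.Aut} {G' : Subgroup X'.Aut}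
    {H' : Subgroup Y'.Aut} {f : X ≃ᵢ X'} {θ : G ≃* G'} {e : Y ≃ᵢ Y'} {η : H ≃* H'}
    (hf : IsEqIso f θ) (he : IsEqIso e η) : eqBox X' G' Y' H' ≤ eqBox X G Y H := by
  refine le_iInf₂ fun π hπ => (iInf₂_le _ (map_mem_couplings hf.1 he.1 hπ)).trans ?_
  have key : ∀ (g : G) (h : H), distPlan (π.map (Prod.map f e)) (Sum.inl (θ g).1.1)
      (Sum.inr (η h).1.1) ≤ distPlan π (Sum.inl g.1.1) (Sum.inr h.1.1) :=
    fun g h => distPlan_map_le f e π _ _ _ _ (hf.2 g) (he.2 h)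
  refine max_le_max ?_ ?_
  · rw [← θ.toEquiv.iSup_comp]
    refine iSup_mono fun g => ?_
    rw [← η.toEquiv.iInf_comp]
    exact iInf_mono fun h => key g h
  · rw [← η.toEquiv.iSup_comp]
    refine iSup_mono fun h => ?_
    rw [← θ.toEquiv.iInf_comp]
    exact iInf_mono fun g => key g h

theorem eqBox_congr {G : Subgroup X.Aut} {H : Subgroup Y.Aut} {G' : Subgroup X'.Aut}
    {H' : Subgroup Y'.Aut} {f : X ≃ᵢ X'} {θ : G ≃* G'} {e : Y ≃ᵢ Y'} {η : H ≃* H'}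
    (hf : IsEqIso f θ) (he : IsEqIso e η) : eqBox X G Y H = eqBox X' G' Y' H' :=
  le_antisymm (eqBox_le hf.symm he.symm) (eqBox_le hf he)

/-- An mm-isomorphism is equivariant for the trivial groups. -/
theorem IsMMIso.isEqIso_bot {f : X ≃ᵢ Y} (hf : IsMMIso f) :
    IsEqIso f (MulEquiv.ofUnique : (⊥ : Subgroup X.Aut) ≃* (⊥ : Subgroup Y.Aut)) := by
  refine ⟨hf, fun g x => ?_⟩
  rw [Subsingleton.elim g 1, map_one]
  rfl

end Invariance

/-- `X` and `Y` are mm-isomorphic. -/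
def Isomorphic (X Y : MMSpace.{u}) : Prop := ∃ f : X ≃ᵢ Y, IsMMIso f

instance setoid : Setoid MMSpace.{u} where
  r := Isomorphic
  iseqv :=
    { refl := fun X => ⟨IsometryEquiv.refl X, MeasurePreserving.id X.μ⟩
      symm := fun ⟨f, hf⟩ => ⟨f.symm, hf.symm⟩
      trans := fun ⟨f, (hf : MeasurePreserving f _ _)⟩ ⟨g, (hg : MeasurePreserving g _ _)⟩ =>
        ⟨f.trans g, hg.comp hf⟩ }

end MMSpace

/-- A pair `(X, G)` of an mm-space and a closed subgroup of `Aut X`. -/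
structure EqMMSpace : Type (u + 1) where
  space : MMSpace.{u}
  group : Subgroup space.Aut
  isClosed : space.IsClosedSubgroup group

namespace EqMMSpace

/-- The equivariant box distance between pairs. -/
noncomputable def box (A B : EqMMSpace.{u}) : ℝ≥0∞ :=
  MMSpace.eqBox A.space A.group B.space B.group

/-- The pairs `A` and `B` are equivariantly mm-isomorphic. -/
def Isomorphic (A B : EqMMSpace.{u}) : Prop :=
  ∃ (f : A.space ≃ᵢ B.space) (θ : A.group ≃* B.group), MMSpace.IsEqIso f θ

instance setoid : Setoid EqMMSpace.{u} where
  r := Isomorphic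
  iseqv :=
    { refl := fun A => ⟨IsometryEquiv.refl A.space, MulEquiv.refl A.group,
        MeasurePreserving.id A.space.μ, fun _ _ => rfl⟩
      symm := fun ⟨f, θ, h⟩ => ⟨f.symm, θ.symm, h.symm⟩
      trans := fun ⟨f, θ, h⟩ ⟨f', θ', h'⟩ =>
        have hf : MeasurePreserving f _ _ := h.1
        have hf' : MeasurePreserving f' _ _ := h'.1
        ⟨f.trans f', θ.trans θ', hf'.comp hf, fun g x => by simp [h.2, h'.2]⟩ }

end EqMMSpace

/-- The set `𝒳` of mm-isomorphism classes of mm-spaces. -/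
def MMClass : Type (u + 1) := Quotient MMSpace.setoid.{u}

/-- The set `𝒳_eq` of equivariant mm-isomorphism classes of pairs. -/
def EqMMClass : Type (u + 1) := Quotient EqMMSpace.setoid.{u}

/-- The box distance on `𝒳`. -/
noncomputable def MMClass.box : MMClass.{u} → MMClass.{u} → ℝ≥0∞ :=
  Quotient.lift₂ MMSpace.box fun _ _ _ _ (h : MMSpace.Isomorphic _ _)
      (h' : MMSpace.Isomorphic _ _) => by
    obtain ⟨_, hf⟩ := h
    obtain ⟨_, he⟩ := h'
    exact MMSpace.eqBox_congr hf.isEqIso_bot he.isEqIso_bot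

/-- The equivariant box distance on `𝒳_eq`. -/
noncomputable def EqMMClass.box : EqMMClass.{u} → EqMMClass.{u} → ℝ≥0∞ :=
  Quotient.lift₂ EqMMSpace.box fun _ _ _ _ (h : EqMMSpace.Isomorphic _ _)
      (h' : EqMMSpace.Isomorphic _ _) => by
    obtain ⟨_, _, hf⟩ := h
    obtain ⟨_, _, he⟩ := h'
    exact MMSpace.eqBox_congr hf he

/-- The topology of the box distance. -/
noncomputable instance : TopologicalSpace MMClass.{u} := distTopology MMClass.box

/-- The topology of the equivariant box distance. -/
noncomputable instance : TopologicalSpace EqMMClass.{u} := distTopology EqMMClass.box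

/-- The projection `(X, G) ↦ X` from `𝒳_eq` to `𝒳`. -/
def EqMMClass.proj : EqMMClass.{u} → MMClass.{u} :=
  Quotient.map EqMMSpace.space fun _ _ (h : EqMMSpace.Isomorphic _ _) =>
    let ⟨f, _, hf⟩ := h
    (⟨f, hf.1⟩ : MMSpace.Isomorphic _ _)

/-! All limits are taken along an ultrafilter `l`. If `box (X i) Y` tends to `0`, there are
couplings `π i` and closed sets `S i` with mass tending to `1` and distortion tending to `0`.
Through these relations a family of points `x i` may converge to a point `y` of `Y`. Full support
makes every `y` such a limit.

The key point is that automorphisms do not let mass escape. If `x i` converges to `y`, balls about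
`g i (x i)` have the same mass as balls about `x i`, which is bounded below. So the partners of `g i
(x i)` in `Y` stay close to a compact set of almost full measure, and they converge
(`Approx.exists_conv_map`). Hence every family `g i` in `(X i).Aut` has a limit in `Y.Aut`
(`Approx.exists_lim`), and this convergence amounts to `distPlan` tending to `0`
(`Approx.eventually_distPlan_le`, `Approx.lim_of_distPlan`).

The limit group `H` consists of all limits of families from the groups `G i`. It is a closed
subgroup, and failure of Hausdorff convergence would produce a family of bad elements whose limit
gives a contradiction. For bad elements of `H` itself this uses compactness of `Y.Aut`, the case of
the diagonal coupling.

Continuity of the projection follows from `box ≤ 2 * eqBox`. Closedness and compact fibres follow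
from the existence of ultrafilter limits over a prescribed `Y`. -/

/-- Choosing, along an ultrafilter with a null sequence, objects that are eventually as good as
any prescribed quality. -/
theorem exists_forall_eventually_of_slack {ι : Type*} {l : Ultrafilter ι} {δ : ι → ℝ}
    (hδ : ∀ i, 0 < δ i) (hδl : Tendsto δ l (𝓝 0)) {α : ι → Type*} [∀ i, Nonempty (α i)]
    {P : ∀ i, ℝ → α i → Prop} (hmono : ∀ i r s a, r ≤ s → P i r a → P i s a)
    (hP : ∀ r > 0, ∀ᶠ i in l, ∃ a, P i r a) :
    ∃ a : ∀ i, α i, ∀ r > 0, ∀ᶠ i in l, P i r (a i) := by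
  have key : ∀ i, ∃ a : α i, ∀ r > 0, (∃ b, P i r b) → P i (r + δ i) a := by
    intro i
    -- The best quality may fail to be attained; an element within `δ i` of the infimum is taken.
    let T : Set ℝ := {r | 0 < r ∧ ∃ b, P i r b}
    by_cases hT : T.Nonempty
    · obtain ⟨r, ⟨hr, b, hb⟩, hlt⟩ := Real.lt_sInf_add_pos hT (hδ i)
      refine ⟨b, fun s hs hsb => hmono i r _ b ?_ hb⟩
      have : sInf T ≤ s := csInf_le ⟨0, fun t ht => ht.1.le⟩ ⟨hs, hsb⟩
      linarith
    · exact ⟨Classical.arbitrary _, fun r hr hb => (hT ⟨r, hr, hb⟩).elim⟩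
  choose a ha using key
  refine ⟨a, fun r hr => ?_⟩
  filter_upwards [hP (r / 2) (half_pos hr), hδl.eventually (gt_mem_nhds (half_pos hr))]
    with i hi hi'
  exact hmono i _ _ _ (by linarith) (ha i _ (half_pos hr) hi)

namespace MMSpace

/-! ### Couplings and the distance `distPlan` -/

section Plans

variable {X Y : MMSpace.{u}} {π : Measure (X × Y)}

theorem isProbabilityMeasure_of_mem_couplings (hπ : π ∈ Couplings X Y) :
    IsProbabilityMeasure π := by
  have h : IsProbabilityMeasure (π.map Prod.fst) := by
    rw [hπ.1]
    infer_instance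
  exact Measure.isProbabilityMeasure_of_map Prod.fst

/-- Mass over `A` lies over `B` or outside `S`. For `B = ∅` this shows that `S` meets the fibre over
any `A` of mass larger than `π Sᶜ`, which is how points of `S` are found below. -/
theorem measure_fst_le (hπ : π ∈ Couplings X Y) {S : Set (X × Y)} {A : Set X} {B : Set Y}
    (hA : MeasurableSet A) (h : ∀ p ∈ S, p.1 ∈ A → p.2 ∈ B) : X.μ A ≤ Y.μ B + π Sᶜ := by
  rw [← hπ.1, Measure.map_apply measurable_fst hA]
  calc π (Prod.fst ⁻¹' A) ≤ π (Prod.snd ⁻¹' B ∪ Sᶜ) := measure_mono fun p hp => by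
        by_cases hS : p ∈ S
        · exact Or.inl (h p hS hp)
        · exact Or.inr hS
    _ ≤ π (Prod.snd ⁻¹' B) + π Sᶜ := measure_union_le _ _
    _ ≤ Y.μ B + π Sᶜ := by
        gcongr
        rw [← hπ.2]
        exact Measure.le_map_apply measurable_snd.aemeasurable B

theorem measure_snd_le (hπ : π ∈ Couplings X Y) {S : Set (X × Y)} {A : Set X} {B : Set Y}
    (hB : MeasurableSet B) (h : ∀ p ∈ S, p.2 ∈ B → p.1 ∈ A) : Y.μ B ≤ X.μ A + π Sᶜ := by
  rw [← hπ.2, Measure.map_apply measurable_snd hB]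
  calc π (Prod.snd ⁻¹' B) ≤ π (Prod.fst ⁻¹' A ∪ Sᶜ) := measure_mono fun p hp => by
        by_cases hS : p ∈ S
        · exact Or.inl (h p hS hp)
        · exact Or.inr hS
    _ ≤ π (Prod.fst ⁻¹' A) + π Sᶜ := measure_union_le _ _
    _ ≤ X.μ A + π Sᶜ := by
        gcongr
        rw [← hπ.1]
        exact Measure.le_map_apply measurable_fst.aemeasurable A

/-- Cutting `S` down to the support of `π` costs no mass, so only closedness is asked of `S`. -/
theorem distPlan_le [IsProbabilityMeasure π] {γ₁ γ₂ : (X → X) ⊕ (Y → Y)} {S : Set (X × Y)}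
    (hS : IsClosed S) {a : ℝ≥0∞} (hm : π Sᶜ ≤ a)
    (hd : ∀ p ∈ S, ∀ q ∈ S,
      ENNReal.ofReal |displacement γ₁ p q - displacement γ₂ p q| ≤ a) :
    distPlan π γ₁ γ₂ ≤ a := by
  refine (iInf_le _ (S ∩ π.support)).trans ((iInf_le _ (hS.inter Measure.isClosed_support)).trans
    ((iInf_le _ Set.inter_subset_right).trans (max_le ?_ ?_)))
  · rw [← prob_compl_eq_one_sub (hS.inter Measure.isClosed_support).measurableSet,
      Set.compl_inter]
    refine (measure_union_le _ _).trans ?_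
    rw [Measure.measure_compl_support, add_zero]
    exact hm
  · exact iSup₂_le fun p hp => iSup₂_le fun q hq => hd p hp.1 q hq.1

theorem exists_of_distPlan_lt [IsProbabilityMeasure π] {γ₁ γ₂ : (X → X) ⊕ (Y → Y)} {a : ℝ≥0∞}
    (h : distPlan π γ₁ γ₂ < a) : ∃ S : Set (X × Y), IsClosed S ∧ π Sᶜ < a ∧
      ∀ p ∈ S, ∀ q ∈ S, ENNReal.ofReal |displacement γ₁ p q - displacement γ₂ p q| < a := by
  simp only [distPlan, iInf_lt_iff, max_lt_iff] at h
  obtain ⟨S, hS, -, h1, h2⟩ := h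
  refine ⟨S, hS, ?_, fun p hp q hq => lt_of_le_of_lt ?_ h2⟩
  · rwa [prob_compl_eq_one_sub hS.measurableSet]
  · exact (le_iSup₂ (f := fun q (_ : q ∈ S) => ENNReal.ofReal
      |displacement γ₁ p q - displacement γ₂ p q|) q hq).trans
      (le_iSup₂ (f := fun p (_ : p ∈ S) => ⨆ q ∈ S, ENNReal.ofReal
        |displacement γ₁ p q - displacement γ₂ p q|) p hp)

/-- Pairs over points where `h` and `h'` differ much are discarded; elsewhere the triangle
inequality applies. -/
theorem distPlan_lt_add_of_kyFan_lt (hπ : π ∈ Couplings X Y) {g : X → X} {h h' : Y → Y}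
    (hc : Continuous h) (hc' : Continuous h') {a b : ℝ≥0∞}
    (ha : distPlan π (Sum.inl g) (Sum.inr h) < a) (hb : Y.kyFan h h' < b) :
    distPlan π (Sum.inl g) (Sum.inr h') ≤ a + b := by
  have := isProbabilityMeasure_of_mem_couplings hπ
  obtain ⟨S, hS, hm, hd⟩ := exists_of_distPlan_lt ha
  obtain ⟨c, hcm, hcb⟩ := sInf_lt_iff.1 hb
  have hT : IsClosed {y : Y | edist (h y) (h' y) ≤ c} :=
    isClosed_le (by fun_prop) continuous_const
  refine distPlan_le (S := S ∩ Prod.snd ⁻¹' {y | edist (h y) (h' y) ≤ c})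
    (hS.inter (hT.preimage continuous_snd)) ?_ ?_
  · rw [Set.compl_inter]
    refine (measure_union_le _ _).trans (add_le_add hm.le ?_)
    rw [← Set.preimage_compl]
    refine (Measure.le_map_apply measurable_snd.aemeasurable _).trans ?_
    rw [hπ.2]
    refine le_trans (le_of_eq ?_) (le_trans hcm hcb.le)
    congr 1
    ext y
    simp
  · intro p hp q hq
    have h1 := (hd p hp.1 q hq.1).le
    have h2 : edist (h p.2) (h' p.2) ≤ b := le_trans hp.2 hcb.le
    rw [edist_dist] at h2
    refine le_trans ?_ (add_le_add h1 h2)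
    rw [← ENNReal.ofReal_add (abs_nonneg _) dist_nonneg]
    apply ENNReal.ofReal_le_ofReal
    simp only [displacement]
    have h3 := abs_dist_sub_le (h p.2) (h' p.2) q.2
    have h4 := abs_sub_le (dist (g p.1) q.1) (dist (h p.2) q.2) (dist (h' p.2) q.2)
    linarith

end Plans

theorem exists_isCompact_lt_measure (Y : MMSpace.{u}) {U : Set Y} (hU : IsOpen U) {a : ℝ≥0∞}
    (ha : a < Y.μ U) : ∃ K ⊆ U, IsCompact K ∧ a < Y.μ K :=
  hU.measurableSet.exists_lt_isCompact_of_ne_top (measure_ne_top _ _) ha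

theorem exists_isCompact_measure_compl_lt (Y : MMSpace.{u}) {a : ℝ≥0∞} (ha : 0 < a) :
    ∃ K : Set Y, IsCompact K ∧ Y.μ Kᶜ < a := by
  obtain ⟨K, -, hK, h⟩ := MeasurableSet.univ.exists_isCompact_sdiff_lt (measure_ne_top Y.μ _) ha.ne'
  exact ⟨K, hK, by rwa [Set.compl_eq_univ_sdiff]⟩

theorem measure_biUnion_ball_apply (X : MMSpace.{u}) {g : X ≃ᵢ X} (hg : g ∈ X.Aut) {κ : Type*}
    (t : Finset κ) (x : κ → X) (r : ℝ) :
    X.μ (⋃ k ∈ t, Metric.ball (g (x k)) r) = X.μ (⋃ k ∈ t, Metric.ball (x k) r) := by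
  have hg' : MeasurePreserving g X.μ X.μ := hg
  have hU : IsOpen (⋃ k ∈ t, Metric.ball (g (x k)) r) :=
    isOpen_biUnion fun _ _ => Metric.isOpen_ball
  rw [← hg'.measure_preimage hU.measurableSet.nullMeasurableSet]
  simp only [Set.preimage_iUnion, g.preimage_ball, g.symm_apply_apply]

/-! ### Convergence of points through almost isometric relations -/

/-- Couplings `π i` of `X i` and `Y` with sets `S i` that show that the box distance of `X i` and
`Y` tends to `0` along `l`. -/
structure Approx {ι : Type*} (l : Ultrafilter ι) (X : ι → MMSpace.{u}) (Y : MMSpace.{u})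
    (π : ∀ i, Measure (X i × Y)) (S : ∀ i, Set (X i × Y)) : Prop where
  coupling : ∀ i, π i ∈ Couplings (X i) Y
  closed : ∀ i, IsClosed (S i)
  mass : ∀ r : ℝ≥0∞, 0 < r → ∀ᶠ i in l, π i (S i)ᶜ < r
  distortion : ∀ r : ℝ, 0 < r → ∀ᶠ i in l, ∀ p ∈ S i, ∀ q ∈ S i,
    |dist p.1 q.1 - dist p.2 q.2| < r

section Conv

variable {ι : Type*} {l : Ultrafilter ι} {X : ι → MMSpace.{u}} {Y : MMSpace.{u}}
  {π : ∀ i, Measure (X i × Y)} {S : ∀ i, Set (X i × Y)}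

/-- The points `x i` and `y i` correspond to each other asymptotically through the sets `S i`. -/
def Conv (l : Ultrafilter ι) (S : ∀ i, Set (X i × Y)) (x : ∀ i, X i) (y : ι → Y) : Prop :=
  ∀ r > 0, ∀ᶠ i in l, ∃ p ∈ S i, dist p.1 (x i) < r ∧ dist p.2 (y i) < r

theorem Conv.congr {x x' : ∀ i, X i} {y y' : ι → Y} (h : Conv l S x y)
    (hx : ∀ r > 0, ∀ᶠ i in l, dist (x i) (x' i) < r)
    (hy : ∀ r > 0, ∀ᶠ i in l, dist (y i) (y' i) < r) : Conv l S x' y' := by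
  intro r hr
  filter_upwards [h _ (half_pos hr), hx _ (half_pos hr), hy _ (half_pos hr)] with i ⟨p, hp, h1, h2⟩
    h3 h4
  exact ⟨p, hp, (dist_triangle _ (x i) _).trans_lt (by linarith),
    (dist_triangle _ (y i) _).trans_lt (by linarith)⟩

variable (D : Approx l X Y π S)
include D

theorem Approx.eventually_abs_dist_sub_lt {x x' : ∀ i, X i} {y y' : ι → Y} (h : Conv l S x y)
    (h' : Conv l S x' y') {r : ℝ} (hr : 0 < r) :
    ∀ᶠ i in l, |dist (x i) (x' i) - dist (y i) (y' i)| < r := by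
  -- One fifth for the distortion and one for each of the four approximations.
  have hr5 : 0 < r / 5 := by positivity
  filter_upwards [h _ hr5, h' _ hr5, D.distortion _ hr5] with i ⟨p, hp, h1, h2⟩ ⟨q, hq, h3, h4⟩ hd
  have h5 := hd p hp q hq
  have h6 := abs_lt.1 h5
  have h7 := dist_dist_dist_le p.1 q.1 (x i) (x' i)
  have h8 := dist_dist_dist_le p.2 q.2 (y i) (y' i)
  rw [Real.dist_eq] at h7 h8
  have h9 := abs_le.1 h7
  have h10 := abs_le.1 h8
  rw [abs_lt]
  constructor <;> linarith

theorem Approx.dist_eq {x x' : ∀ i, X i} {y y' z z' : Y} (h : Conv l S x fun _ => y)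
    (h' : Conv l S x' fun _ => y') {w w' : ∀ i, X i} (k : Conv l S w fun _ => z)
    (k' : Conv l S w' fun _ => z') (hd : ∀ i, dist (x i) (x' i) = dist (w i) (w' i)) :
    dist y y' = dist z z' := by
  refine eq_of_abs_sub_le_all fun r hr => ?_
  have h1 := (D.eventually_abs_dist_sub_lt h h' (half_pos hr))
  have h2 := (D.eventually_abs_dist_sub_lt k k' (half_pos hr))
  obtain ⟨i, h1, h2⟩ := (h1.and h2).exists
  rw [hd] at h1
  have := abs_lt.1 h1
  have := abs_lt.1 h2
  rw [abs_le]
  constructor <;> linarith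

/-- Small distortion forces this uniformly over `S i`, at the price of enlarging the radius. -/
theorem Approx.eventually_dist_fst_lt {x : ∀ i, X i} {y : ι → Y} (h : Conv l S x y) {r s : ℝ}
    (hrs : r < s) :
    ∀ᶠ i in l, ∀ p ∈ S i, dist p.2 (y i) < r → dist p.1 (x i) < s := by
  have hr3 : 0 < (s - r) / 3 := by linarith
  filter_upwards [h _ hr3, D.distortion _ hr3] with i ⟨p, hp, h1, h2⟩ hd q hq hqy
  have h3 := abs_lt.1 (hd q hq p hp)
  have h4 := dist_triangle q.1 p.1 (x i)
  have h5 := dist_triangle_right q.2 p.2 (y i)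
  linarith

theorem Approx.eventually_dist_snd_lt {x : ∀ i, X i} {y : ι → Y} (h : Conv l S x y) {r s : ℝ}
    (hrs : r < s) :
    ∀ᶠ i in l, ∀ p ∈ S i, dist p.1 (x i) < r → dist p.2 (y i) < s := by
  have hr3 : 0 < (s - r) / 3 := by linarith
  filter_upwards [h _ hr3, D.distortion _ hr3] with i ⟨p, hp, h1, h2⟩ hd q hq hqy
  have h3 := abs_lt.1 (hd q hq p hp)
  have h4 := dist_triangle q.2 p.2 (y i)
  have h5 := dist_triangle_right q.1 p.1 (x i)
  linarith

theorem Approx.eventually_measure_le {κ : Type*} (t : Finset κ) {x : κ → ∀ i, X i}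
    {y : κ → ι → Y} (h : ∀ k, Conv l S (x k) (y k)) {r s : ℝ} (hrs : r < s) :
    ∀ᶠ i in l, Y.μ (⋃ k ∈ t, Metric.ball (y k i) r) ≤
      (X i).μ (⋃ k ∈ t, Metric.ball (x k i) s) + π i (S i)ᶜ := by
  have : ∀ᶠ i in l, ∀ k ∈ t, ∀ p ∈ S i, dist p.2 (y k i) < r → dist p.1 (x k i) < s :=
    (eventually_all_finset t).2 fun k _ => D.eventually_dist_fst_lt (h k) hrs
  filter_upwards [this] with i hi
  refine measure_snd_le (D.coupling i) (isOpen_biUnion fun _ _ => Metric.isOpen_ball).measurableSet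
    fun p hp hpt => ?_
  simp only [Set.mem_iUnion, Metric.mem_ball] at hpt ⊢
  obtain ⟨k, hk, hpk⟩ := hpt
  exact ⟨k, hk, hi k hk p hp hpk⟩

theorem Approx.eventually_measure_le' {κ : Type*} (t : Finset κ) {x : κ → ∀ i, X i}
    {y : κ → ι → Y} (h : ∀ k, Conv l S (x k) (y k)) {r s : ℝ} (hrs : r < s) :
    ∀ᶠ i in l, (X i).μ (⋃ k ∈ t, Metric.ball (x k i) r) ≤
      Y.μ (⋃ k ∈ t, Metric.ball (y k i) s) + π i (S i)ᶜ := by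
  have : ∀ᶠ i in l, ∀ k ∈ t, ∀ p ∈ S i, dist p.1 (x k i) < r → dist p.2 (y k i) < s :=
    (eventually_all_finset t).2 fun k _ => D.eventually_dist_snd_lt (h k) hrs
  filter_upwards [this] with i hi
  refine measure_fst_le (D.coupling i) (isOpen_biUnion fun _ _ => Metric.isOpen_ball).measurableSet
    fun p hp hpt => ?_
  simp only [Set.mem_iUnion, Metric.mem_ball] at hpt ⊢
  obtain ⟨k, hk, hpk⟩ := hpt
  exact ⟨k, hk, hi k hk p hp hpk⟩

variable {δ : ι → ℝ} (hδ : ∀ i, 0 < δ i) (hδl : Tendsto δ l (𝓝 0))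
include hδ hδl

/-- Balls about `y` have positive mass, so eventually `S i` contains a pair over them. -/
theorem Approx.exists_conv (y : Y) : ∃ x, Conv l S x fun _ => y := by
  have hne : ∀ i, Nonempty (X i) := fun i => (X i).μ.nonempty_of_neZero
  refine exists_forall_eventually_of_slack hδ hδl
    (P := fun i r x => ∃ p ∈ S i, dist p.1 x < r ∧ dist p.2 y < r) ?_ ?_
  · rintro i r s x hrs ⟨p, hp, h1, h2⟩
    exact ⟨p, hp, h1.trans_le hrs, h2.trans_le hrs⟩
  · intro r hr
    filter_upwards [D.mass _ (Metric.measure_ball_pos Y.μ y hr)] with i hi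
    by_contra hcon
    push Not at hcon
    refine hi.not_ge ?_
    have := measure_snd_le (D.coupling i) (S := S i) (A := ∅) (B := Metric.ball y r)
      Metric.isOpen_ball.measurableSet
      fun p hp hpy => (hcon p.1 p hp (by simpa using hr)).not_gt hpy
    simpa using this

theorem Approx.exists_conv_map {x : ∀ i, X i} {y : Y} (h : Conv l S x fun _ => y)
    {g : ∀ i, X i ≃ᵢ X i} (hg : ∀ i, g i ∈ (X i).Aut) :
    ∃ y', Conv l S (fun i => g i (x i)) fun _ => y' := by
  have hne : Nonempty Y := ⟨y⟩
  -- Invariance of the measure under `g i` bounds these masses below; half of the mass near `y` is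
  -- given up to the complement of `S i`.
  have hball : ∀ r > 0, ∃ c > 0, ∀ᶠ i in l, c ≤ (X i).μ (Metric.ball (g i (x i)) r) := by
    intro r hr
    have hpos := Metric.measure_ball_pos Y.μ y (half_pos hr)
    refine ⟨Y.μ (Metric.ball y (r / 2)) / 2, ENNReal.half_pos hpos.ne', ?_⟩
    filter_upwards [D.eventually_measure_le {()} (x := fun _ => x) (fun _ => h) (half_lt_self hr),
      D.mass _ (ENNReal.half_pos hpos.ne')] with i h1 h2
    have h3 := (X i).measure_biUnion_ball_apply (hg i) {()} (fun _ => x i) r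
    simp only [Finset.mem_singleton, Set.iUnion_const] at h1 h3
    rw [← h3] at h1
    by_contra hcon
    push Not at hcon
    have := ENNReal.add_lt_add hcon h2
    rw [ENNReal.add_halves] at this
    exact (h1.trans_lt this).false
  obtain ⟨z, hz⟩ : ∃ z, Conv l S (fun i => g i (x i)) z := by
    refine exists_forall_eventually_of_slack hδ hδl (α := fun _ => Y)
      (P := fun i r y => ∃ p ∈ S i, dist p.1 (g i (x i)) < r ∧ dist p.2 y < r) ?_ ?_
    · rintro i r s x hrs ⟨p, hp, h1, h2⟩
      exact ⟨p, hp, h1.trans_le hrs, h2.trans_le hrs⟩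
    · intro r hr
      obtain ⟨c, hc, hcb⟩ := hball r hr
      filter_upwards [D.mass c hc, hcb] with i h1 h2
      by_contra hcon
      push Not at hcon
      refine (h2.trans ?_).not_gt h1
      have := measure_fst_le (D.coupling i) (S := S i) (B := ∅)
        (A := Metric.ball (g i (x i)) r) Metric.isOpen_ball.measurableSet
        fun p hp hpy => (hcon p.2 p hp hpy).not_gt (by simpa using hr)
      simpa using this
  -- A ball about `z i` has too much mass to miss a compact `K` of almost full measure. So `z i` is
  -- near `K`, and the ultrafilter selects one ball of a finite cover.
  have hcauchy : Cauchy (map z l) := by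
    refine Metric.cauchy_iff.2 ⟨inferInstance, fun r hr => ?_⟩
    have hr' : 0 < r / 8 := by positivity
    obtain ⟨c, hc, hcb⟩ := hball (r / 8) hr'
    obtain ⟨K, hK, hKc⟩ := Y.exists_isCompact_measure_compl_lt (ENNReal.half_pos hc.ne')
    have hev : ∀ᶠ i in l, ∃ k ∈ K, dist (z i) k < r / 4 := by
      filter_upwards [D.eventually_measure_le' {()} (y := fun _ => z) (fun _ => hz)
        (show r / 8 < r / 4 by linarith), hcb, D.mass _ (ENNReal.half_pos hc.ne')] with i h1 h2 h3
      by_contra hcon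
      push Not at hcon
      simp only [Finset.mem_singleton, Set.iUnion_const] at h1
      have h4 : Y.μ (Metric.ball (z i) (r / 4)) ≤ Y.μ Kᶜ := measure_mono fun k hk hkK =>
        (hcon k hkK).not_gt (by rwa [dist_comm])
      have h5 := ENNReal.add_lt_add (h4.trans_lt hKc) h3
      rw [ENNReal.add_halves] at h5
      exact ((h2.trans h1).trans_lt h5).false
    obtain ⟨t, -, htK⟩ := hK.elim_nhds_subcover (fun k => Metric.ball k (r / 4))
      fun k _ => Metric.ball_mem_nhds k (by positivity)
    have : ∀ᶠ i in l, ∃ k ∈ t, dist (z i) k < r / 2 := by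
      filter_upwards [hev] with i ⟨k, hkK, hk⟩
      obtain ⟨k', hk't, hk'⟩ := Set.mem_iUnion₂.1 (htK hkK)
      refine ⟨k', hk't, (dist_triangle _ k _).trans_lt ?_⟩
      have := Metric.mem_ball.1 hk'
      linarith
    obtain ⟨k, -, hk⟩ := (l.eventually_exists_mem_iff (is := (t : Set Y)) t.finite_toSet).1 this
    refine ⟨Metric.ball k (r / 2), hk, fun a ha b hb => ?_⟩
    have := dist_triangle_right a b k
    rw [Metric.mem_ball] at ha hb
    linarith
  obtain ⟨y', hy'⟩ := CompleteSpace.complete hcauchy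
  refine ⟨y', hz.congr (fun r hr => by simpa using hr) fun r hr => ?_⟩
  exact (show Tendsto z l (𝓝 y') from hy').eventually (Metric.ball_mem_nhds y' hr)

end Conv

end MMSpace

/-! ### Limits of automorphisms -/

namespace MMSpace

section Lim

variable {ι : Type*} {l : Ultrafilter ι} {X : ι → MMSpace.{u}} {Y : MMSpace.{u}}
  {π : ∀ i, Measure (X i × Y)} {S : ∀ i, Set (X i × Y)}

/-- The isometries `g i` converge to the map `h` through the sets `S i`. -/
def Lim (l : Ultrafilter ι) (S : ∀ i, Set (X i × Y)) (g : ∀ i, X i ≃ᵢ X i) (h : Y → Y) : Prop :=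
  ∀ x y, Conv l S x (fun _ => y) → Conv l S (fun i => g i (x i)) fun _ => h y

variable (D : Approx l X Y π S)

theorem Lim.mul {g g' : ∀ i, X i ≃ᵢ X i} {h h' : Y → Y} (H : Lim l S g h) (H' : Lim l S g' h') :
    Lim l S (fun i => g i * g' i) (h ∘ h') :=
  fun _ _ hxy => H _ _ (H' _ _ hxy)

include D

/-- The distances of `x i` and `x' i` tend to `0`. This makes limits of images independent of the
approximating family. -/
theorem Approx.conv_of_dist_eq {x x' : ∀ i, X i} {y : Y} (h : Conv l S x fun _ => y)
    (h' : Conv l S x' fun _ => y) {w w' : ∀ i, X i} {z : ι → Y} (k : Conv l S w z)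
    (hd : ∀ i, dist (x i) (x' i) = dist (w i) (w' i)) : Conv l S w' z := by
  refine k.congr (fun r hr => ?_) fun r hr => by simpa using hr
  filter_upwards [D.eventually_abs_dist_sub_lt h h' hr] with i hi
  simpa [hd] using hi

variable {δ : ι → ℝ} (hδ : ∀ i, 0 < δ i) (hδl : Tendsto δ l (𝓝 0))
include hδ hδl

theorem Approx.lim_inv {g : ∀ i, X i ≃ᵢ X i} {h : Y ≃ᵢ Y} (H : Lim l S g h) :
    Lim l S (fun i => (g i)⁻¹) ⇑h⁻¹ := by
  intro x y hxy
  obtain ⟨w, hw⟩ := D.exists_conv hδ hδl (h⁻¹ y)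
  have h1 := H _ _ hw
  rw [show h (h⁻¹ y) = y from h.apply_symm_apply y] at h1
  refine D.conv_of_dist_eq h1 hxy hw fun i => ?_
  rw [← (g i).dist_eq (w i) ((g i)⁻¹ (x i))]
  congr 1
  exact ((g i).apply_symm_apply _).symm

theorem Approx.exists_lim_fun {g : ∀ i, X i ≃ᵢ X i} (hg : ∀ i, g i ∈ (X i).Aut) :
    ∃ h : Y → Y, Lim l S g h := by
  choose w hw using D.exists_conv hδ hδl
  choose h hh using fun y => D.exists_conv_map hδ hδl (hw y) hg
  exact ⟨h, fun x y hxy => D.conv_of_dist_eq (hw y) hxy (hh y) fun i => ((g i).dist_eq _ _).symm⟩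

theorem Approx.lim_ext {g : ∀ i, X i ≃ᵢ X i} {h h' : Y → Y} (H : Lim l S g h)
    (H' : Lim l S g h') : h = h' := by
  funext y
  obtain ⟨w, hw⟩ := D.exists_conv hδ hδl y
  rw [← dist_eq_zero, D.dist_eq (H _ _ hw) (H' _ _ hw) hw hw (by simp), dist_self]

/-- Limits are unique and compatible with composition, so the limit of the inverses inverts the
limit. -/
theorem Approx.exists_lim_isometryEquiv {g : ∀ i, X i ≃ᵢ X i} (hg : ∀ i, g i ∈ (X i).Aut) :
    ∃ h : Y ≃ᵢ Y, Lim l S g h := by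
  obtain ⟨h, H⟩ := D.exists_lim_fun hδ hδl hg
  obtain ⟨k, K⟩ := D.exists_lim_fun hδ hδl (g := fun i => (g i)⁻¹) fun i => (X i).Aut.inv_mem (hg i)
  have hid : Lim l S (fun i => (1 : X i ≃ᵢ X i)) id := fun x y hxy => hxy
  have h1 := D.lim_ext hδ hδl (by simpa using H.mul K) hid
  have h2 := D.lim_ext hδ hδl (by simpa using K.mul H) hid
  have hi : Isometry h := Isometry.of_dist_eq fun y y' => by
    obtain ⟨w, hw⟩ := D.exists_conv hδ hδl y
    obtain ⟨w', hw'⟩ := D.exists_conv hδ hδl y'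
    exact D.dist_eq (H _ _ hw) (H _ _ hw') hw hw' fun i => (g i).dist_eq _ _
  exact ⟨⟨⟨h, k, congrFun h2, congrFun h1⟩, hi⟩, H⟩

/-- A compact part of `U` is covered by finitely many balls, which are carried to `X i`, moved by `g
i` without change of mass, and carried back into `h '' U`. The radii `s / 3 < s / 2 < s` leave room
for the two transfers. -/
theorem Approx.measure_le_image {g : ∀ i, X i ≃ᵢ X i} (hg : ∀ i, g i ∈ (X i).Aut)
    {h : Y ≃ᵢ Y} (H : Lim l S g h) {U : Set Y} (hU : IsOpen U) : Y.μ U ≤ Y.μ (h '' U) := by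
  refine le_of_forall_lt fun c hc => ?_
  obtain ⟨K, hKU, hK, hcK⟩ := Y.exists_isCompact_lt_measure hU hc
  refine hcK.trans_le (ENNReal.le_of_forall_pos_le_add fun r hr _ => ?_)
  obtain ⟨s, hs, hsU⟩ := hK.exists_thickening_subset_open hU hKU
  obtain ⟨t, htK, ht⟩ := hK.elim_nhds_subcover (fun k => Metric.ball k (s / 3))
    fun k _ => Metric.ball_mem_nhds k (by positivity)
  choose w hw using D.exists_conv hδ hδl
  have hr2 : (0 : ℝ≥0∞) < r / 2 := ENNReal.half_pos (by exact_mod_cast hr.ne')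
  obtain ⟨i, h1, h2, h3⟩ := ((D.eventually_measure_le t hw (show s / 3 < s / 2 by linarith)).and
    ((D.eventually_measure_le' t (fun y => H _ _ (hw y)) (show s / 2 < s by linarith)).and
    (D.mass _ hr2))).exists
  rw [(X i).measure_biUnion_ball_apply (hg i)] at h2
  calc Y.μ K ≤ Y.μ (⋃ k ∈ t, Metric.ball k (s / 3)) := measure_mono ht
    _ ≤ _ := h1
    _ ≤ Y.μ (⋃ k ∈ t, Metric.ball (h k) s) + π i (S i)ᶜ + π i (S i)ᶜ := by gcongr
    _ ≤ Y.μ (h '' U) + r / 2 + r / 2 := by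
        gcongr
        refine Set.iUnion₂_subset fun k hk => ?_
        rw [← h.image_ball]
        exact Set.image_mono ((Metric.ball_subset_thickening (htK k hk) s).trans hsU)
    _ = _ := by rw [add_assoc, ENNReal.add_halves]

/-- The inequality on open sets for the limit and for its inverse gives equality there, and open
sets form a generating π-system. -/
theorem Approx.exists_lim {g : ∀ i, X i ≃ᵢ X i} (hg : ∀ i, g i ∈ (X i).Aut) :
    ∃ h ∈ Y.Aut, Lim l S g h := by
  obtain ⟨h, H⟩ := D.exists_lim_isometryEquiv hδ hδl hg
  refine ⟨h, ⟨h.continuous.measurable, ?_⟩, H⟩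
  refine (ext_of_generate_finite _ (BorelSpace.measurable_eq (α := Y)) isPiSystem_isOpen ?_ ?_)
  · intro U hU
    rw [Measure.map_apply h.continuous.measurable (IsOpen.measurableSet hU)]
    refine le_antisymm ?_ ?_
    · refine (D.measure_le_image hδ hδl hg H (IsOpen.preimage h.continuous hU)).trans_eq ?_
      rw [Set.image_preimage_eq _ h.surjective]
    · have := D.measure_le_image hδ hδl (fun i => (X i).Aut.inv_mem (hg i))
        (D.lim_inv hδ hδl H) hU
      rwa [show ⇑h⁻¹ = h.symm from rfl, h.image_symm] at this
  · rw [Measure.map_apply h.continuous.measurable MeasurableSet.univ, Set.preimage_univ]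

/-- Isometries are equicontinuous, so convergence on a finite net of a compact set of almost full
measure suffices. -/
theorem Approx.eventually_distPlan_le {g : ∀ i, X i ≃ᵢ X i} {h : Y ≃ᵢ Y} (H : Lim l S g h)
    {ε : ℝ} (hε : 0 < ε) :
    ∀ᶠ i in l, distPlan (π i) (Sum.inl (g i)) (Sum.inr h) ≤ ENNReal.ofReal ε := by
  obtain ⟨K, hK, hKm⟩ := Y.exists_isCompact_measure_compl_lt
    (a := ENNReal.ofReal (ε / 2)) (by simpa using hε)
  obtain ⟨t, htK, ht⟩ := hK.elim_nhds_subcover (fun k => Metric.ball k (ε / 9))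
    fun k _ => Metric.ball_mem_nhds k (by positivity)
  choose w hw using D.exists_conv hδ hδl
  have h9 : ε / 9 < ε / 8 := by linarith
  have e1 := (eventually_all_finset t).2 fun k _ => D.eventually_dist_fst_lt (hw k) h9
  have e2 := (eventually_all_finset t).2 fun k _ => H _ _ (hw k) (ε / 9) (by positivity)
  filter_upwards [e1, e2, D.mass (ENNReal.ofReal (ε / 2)) (by simpa using hε),
    D.distortion (ε / 9) (by positivity)] with i h1 h2 h3 h4
  have := isProbabilityMeasure_of_mem_couplings (D.coupling i)
  refine distPlan_le (S := S i ∩ Prod.snd ⁻¹' K)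
    ((D.closed i).inter (hK.isClosed.preimage continuous_snd)) ?_ ?_
  · rw [Set.compl_inter]
    refine (measure_union_le _ _).trans ?_
    rw [← Set.preimage_compl, show ENNReal.ofReal ε = ENNReal.ofReal (ε / 2) +
      ENNReal.ofReal (ε / 2) by rw [← ENNReal.ofReal_add] <;> first | positivity | simp]
    refine add_le_add h3.le (le_trans ?_ hKm.le)
    rw [← (D.coupling i).2]
    exact Measure.le_map_apply measurable_snd.aemeasurable _
  · rintro p ⟨hp, hpK⟩ q ⟨hq, -⟩
    apply ENNReal.ofReal_le_ofReal
    obtain ⟨k, hk, hpk⟩ := Set.mem_iUnion₂.1 (ht hpK)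
    rw [Metric.mem_ball] at hpk
    obtain ⟨p', hp', h5, h6⟩ := h2 k hk
    have h7 := h1 k hk p hp hpk
    have h8 := abs_lt.1 (h4 p' hp' q hq)
    rw [← (g i).dist_eq] at h7
    rw [← h.dist_eq] at hpk
    have h9 := abs_le.1 (abs_dist_sub_le (g i p.1) (g i (w k i)) q.1)
    have h10 := abs_le.1 (abs_dist_sub_le p'.1 (g i (w k i)) q.1)
    have h11 := abs_le.1 (abs_dist_sub_le (h p.2) (h k) q.2)
    have h12 := abs_le.1 (abs_dist_sub_le p'.2 (h k) q.2)
    simp only [displacement]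
    rw [abs_le]
    constructor <;> linarith

omit hδ hδl in
-- Pairs `p` near `y` and `q` near `h y` exist in the good sets; small displacement difference at
-- `(p, q)` puts `q.1` near `g i (x i)`.
theorem Approx.lim_of_distPlan {g : ∀ i, X i ≃ᵢ X i} {h : Y → Y} (hh : Isometry h)
    (H : ∀ ε > 0, ∀ᶠ i in l,
      distPlan (π i) (Sum.inl (g i)) (Sum.inr h) < ENNReal.ofReal ε) : Lim l S g h := by
  intro x y hxy r hr
  obtain ⟨s, hs, hs1, hs2⟩ : ∃ s > 0, ENNReal.ofReal s ≤ Y.μ (Metric.ball y (r / 8)) / 2 ∧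
      ENNReal.ofReal s ≤ Y.μ (Metric.ball (h y) (r / 8)) / 2 := by
    have hpos : 0 < min (Y.μ (Metric.ball y (r / 8)) / 2) (Y.μ (Metric.ball (h y) (r / 8)) / 2) :=
      lt_min (ENNReal.half_pos (Metric.measure_ball_pos _ _ (by positivity)).ne')
        (ENNReal.half_pos (Metric.measure_ball_pos _ _ (by positivity)).ne')
    obtain ⟨s, hs, hs'⟩ := ENNReal.lt_iff_exists_real_btwn.1 hpos
    exact ⟨s, by simpa using hs'.1, hs'.2.le.trans (min_le_left _ _),
      hs'.2.le.trans (min_le_right _ _)⟩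
  filter_upwards [H (min s (r / 8)) (by positivity), D.mass _ (ENNReal.ofReal_pos.2 hs),
    D.eventually_dist_fst_lt hxy (show r / 8 < r / 4 by linarith)] with i h1 h2 h3
  have := isProbabilityMeasure_of_mem_couplings (D.coupling i)
  obtain ⟨T, hT, hTm, hTd⟩ := exists_of_distPlan_lt h1
  have hfind : ∀ z, ENNReal.ofReal s ≤ Y.μ (Metric.ball z (r / 8)) / 2 →
      ∃ p ∈ S i ∩ T, dist p.2 z < r / 8 := by
    intro z hz
    by_contra hcon
    push Not at hcon
    have h4 := measure_snd_le (D.coupling i) (S := S i ∩ T) (A := ∅) (B := Metric.ball z (r / 8))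
      Metric.isOpen_ball.measurableSet fun p hp hpz => (hcon p hp).not_gt hpz
    rw [measure_empty, zero_add, Set.compl_inter] at h4
    have h5 := ENNReal.add_lt_add (h2.trans_le hz) (hTm.trans_le ((ENNReal.ofReal_le_ofReal
      (min_le_left _ _)).trans hz))
    rw [ENNReal.add_halves] at h5
    exact ((h4.trans (measure_union_le _ _)).trans_lt h5).false
  obtain ⟨p, hp, hpy⟩ := hfind y hs1
  obtain ⟨q, hq, hqy⟩ := hfind (h y) hs2
  have h6 := hTd p hp.2 q hq.2
  have h6' := abs_lt.1 ((ENNReal.ofReal_lt_ofReal_iff (by positivity)).1 h6)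
  have h7 := h3 p hp.1 hpy
  have h8 : min s (r / 8) ≤ r / 8 := min_le_right _ _
  simp only [displacement] at h6'
  rw [← (g i).dist_eq] at h7
  rw [← hh.dist_eq] at hpy
  have h9 := dist_triangle_left q.1 (g i (x i)) (g i p.1)
  have h10 := dist_triangle_right (h p.2) q.2 (h y)
  exact ⟨q, hq.1, by linarith, by linarith⟩

end Lim

end MMSpace

/-! ### Compactness of `Aut` and the limit group -/

namespace MMSpace

theorem kyFan_comm (X : MMSpace.{u}) (f g : X → X) : X.kyFan f g = X.kyFan g f := by
  simp only [kyFan, edist_comm]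

theorem isClosedSubgroup_of_forall {X : MMSpace.{u}} {G : Subgroup X.Aut}
    (h : ∀ f : X.Aut, (∀ ε > 0, ∃ g ∈ G, X.kyFan f.1 g.1 < ε) → f ∈ G) :
    X.IsClosedSubgroup G := by
  refine @IsClosed.mk _ (distTopology fun f g : X.Aut => X.kyFan f.1 g.1) _ fun f hf => ?_
  by_contra hcon
  push Not at hcon
  refine hf (h f fun ε hε => ?_)
  obtain ⟨g, hg, hgG⟩ := hcon ε hε
  exact ⟨g, Set.notMem_compl_iff.1 hgG, hg⟩

theorem map_prodMk_mem_couplings {X Y : MMSpace.{u}} {f : X → Y}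
    (hf : MeasurePreserving f X.μ Y.μ) : X.μ.map (fun x => (x, f x)) ∈ Couplings X Y := by
  have hm : Measurable fun x => (x, f x) := measurable_id.prodMk hf.measurable
  refine ⟨?_, ?_⟩
  · rw [Measure.map_map measurable_fst hm]
    exact Measure.map_id
  · rw [Measure.map_map measurable_snd hm]
    exact hf.map_eq

theorem approx_diagonal {ι : Type*} (l : Ultrafilter ι) (Y : MMSpace.{u}) :
    Approx l (fun _ => Y) Y (fun _ => Y.μ.map fun y => (y, y)) fun _ => Set.diagonal Y where
  coupling _ := map_prodMk_mem_couplings (MeasurePreserving.id Y.μ)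
  closed _ := isClosed_diagonal
  mass r hr := Eventually.of_forall fun _ => by
    rw [Measure.map_apply (by fun_prop) isClosed_diagonal.measurableSet.compl]
    simpa [Set.preimage, Set.diagonal] using hr
  distortion r hr := Eventually.of_forall fun _ p hp q hq => by
    rw [Set.mem_diagonal_iff.1 hp, Set.mem_diagonal_iff.1 hq]
    simpa using hr

/-- Compactness of the automorphism group for the Ky Fan distance. -/
theorem exists_eventually_kyFan_le {ι : Type*} {l : Ultrafilter ι} {δ : ι → ℝ}
    (hδ : ∀ i, 0 < δ i) (hδl : Tendsto δ l (𝓝 0)) {Y : MMSpace.{u}} (f : ι → Y.Aut) :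
    ∃ h : Y.Aut, ∀ ε > 0, ∀ᶠ i in l, Y.kyFan h.1 (f i).1 ≤ ENNReal.ofReal ε := by
  obtain ⟨h, hh, H⟩ := (approx_diagonal l Y).exists_lim hδ hδl (g := fun i => (f i).1)
    fun i => (f i).2
  refine ⟨⟨h, hh⟩, fun ε hε => ?_⟩
  obtain ⟨K, hK, hKm⟩ := Y.exists_isCompact_measure_compl_lt (ENNReal.ofReal_pos.2 hε)
  obtain ⟨t, htK, ht⟩ := hK.elim_nhds_subcover (fun k => Metric.ball k (ε / 4))
    fun k _ => Metric.ball_mem_nhds k (by positivity)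
  -- Constant families converge through the diagonal, so `H` gives pointwise convergence on the net
  -- `t`.
  have hconv : ∀ y : Y, Conv l (fun _ => Set.diagonal Y) (fun _ => y) fun _ => y := fun y r hr =>
    Eventually.of_forall fun _ => ⟨(y, y), rfl, by simpa using hr, by simpa using hr⟩
  filter_upwards [(eventually_all_finset t).2
    fun k _ => H _ _ (hconv k) (ε / 4) (by positivity)] with i hi
  refine sInf_le (le_trans (measure_mono fun y hy => ?_) hKm.le)
  intro hyK
  refine (not_le_of_gt (Set.mem_ofPred.1 hy)) ?_
  obtain ⟨k, hk, hyk⟩ := Set.mem_iUnion₂.1 (ht hyK)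
  obtain ⟨⟨p, q⟩, hpq, h1, h2⟩ := hi k hk
  obtain rfl : p = q := hpq
  rw [edist_dist]
  apply ENNReal.ofReal_le_ofReal
  rw [Metric.mem_ball] at hyk
  have h3 := (f i).1.dist_eq y k
  have h4 := h.dist_eq y k
  have h5 := dist_triangle4 (h y) (h k) ((f i).1 k) ((f i).1 y)
  have h6 := dist_triangle_left (h k) ((f i).1 k) p
  rw [dist_comm ((f i).1 k)] at h5
  dsimp only at h1 h2 ⊢
  linarith

section LimSubgroup

variable {ι : Type*} {l : Ultrafilter ι} {X : ι → MMSpace.{u}} {Y : MMSpace.{u}}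
  {π : ∀ i, Measure (X i × Y)} {S : ∀ i, Set (X i × Y)} (D : Approx l X Y π S)
  {δ : ι → ℝ} (hδ : ∀ i, 0 < δ i) (hδl : Tendsto δ l (𝓝 0)) (G : ∀ i, Subgroup (X i).Aut)

/-- The group of all limits of elements of the groups `G i`. -/
def Approx.limSubgroup : Subgroup Y.Aut where
  carrier := {h | ∃ g : ∀ i, G i, Lim l S (fun i => (g i).1.1) h.1}
  mul_mem' := by
    rintro h h' ⟨g, hg⟩ ⟨g', hg'⟩
    exact ⟨fun i => g i * g' i, hg.mul hg'⟩
  one_mem' := ⟨fun _ => 1, fun _ _ hxy => hxy⟩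
  inv_mem' := by
    rintro h ⟨g, hg⟩
    exact ⟨fun i => (g i)⁻¹, D.lim_inv hδ hδl hg⟩

/-- A diagonal argument: families approximating ever closer elements `h'` are merged into one family
by the slack lemma. -/
theorem Approx.mem_limSubgroup_of_kyFan (h : Y.Aut)
    (hh : ∀ ε > 0, ∃ h' ∈ D.limSubgroup hδ hδl G, Y.kyFan h.1 h'.1 < ε) :
    h ∈ D.limSubgroup hδ hδl G := by
  obtain ⟨g, hg⟩ := exists_forall_eventually_of_slack hδ hδl (α := fun i => G i)
    (P := fun i r g => distPlan (π i) (Sum.inl g.1.1) (Sum.inr h.1) < ENNReal.ofReal r)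
    (fun i r s g hrs hr => hr.trans_le (ENNReal.ofReal_le_ofReal hrs)) fun r hr => by
      obtain ⟨h', ⟨g, hg⟩, hk⟩ := hh (ENNReal.ofReal (r / 3)) (by simpa using hr)
      filter_upwards [D.eventually_distPlan_le hδ hδl hg (show 0 < r / 4 by positivity)] with i hi
      refine ⟨g i, (distPlan_lt_add_of_kyFan_lt (D.coupling i) h'.1.continuous h.1.continuous
        (hi.trans_lt ((ENNReal.ofReal_lt_ofReal_iff (q := r / 3) (by positivity)).2
          (by linarith))) (by rwa [kyFan_comm])).trans_lt ?_⟩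
      rw [← ENNReal.ofReal_add (by positivity) (by positivity)]
      exact (ENNReal.ofReal_lt_ofReal_iff hr).2 (by linarith)
  exact ⟨g, D.lim_of_distPlan h.1.isometry hg⟩

theorem Approx.isClosedSubgroup_limSubgroup :
    Y.IsClosedSubgroup (D.limSubgroup hδ hδl G) :=
  isClosedSubgroup_of_forall (D.mem_limSubgroup_of_kyFan hδ hδl G)

theorem Approx.eventually_forall_exists_mem_limSubgroup {ε : ℝ} (hε : 0 < ε) :
    ∀ᶠ i in l, ∀ g : G i, ∃ h : D.limSubgroup hδ hδl G,
      distPlan (π i) (Sum.inl g.1.1) (Sum.inr h.1.1) ≤ ENNReal.ofReal ε := by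
  by_contra hcon
  rw [← Ultrafilter.eventually_not] at hcon
  -- A bad element where one exists, and `1` as a default elsewhere.
  have : ∀ i, ∃ g : G i, (¬ ∀ g : G i, ∃ h : D.limSubgroup hδ hδl G,
      distPlan (π i) (Sum.inl g.1.1) (Sum.inr h.1.1) ≤ ENNReal.ofReal ε) →
      ¬ ∃ h : D.limSubgroup hδ hδl G,
        distPlan (π i) (Sum.inl g.1.1) (Sum.inr h.1.1) ≤ ENNReal.ofReal ε := fun i => by
    by_cases hi : ∀ g : G i, ∃ h : D.limSubgroup hδ hδl G,
      distPlan (π i) (Sum.inl g.1.1) (Sum.inr h.1.1) ≤ ENNReal.ofReal ε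
    · exact ⟨1, fun h => (h hi).elim⟩
    · obtain ⟨g, hg⟩ := not_forall.1 hi
      exact ⟨g, fun _ => hg⟩
  choose g hg using this
  obtain ⟨h, hh, H⟩ := D.exists_lim hδ hδl (g := fun i => (g i).1.1) fun i => (g i).1.2
  obtain ⟨i, h1, h2⟩ := (hcon.and (D.eventually_distPlan_le hδ hδl H hε)).exists
  exact hg i h1 ⟨⟨⟨h, hh⟩, g, H⟩, h2⟩

/-- Bad elements `f i` would have a Ky Fan limit `h`, in the group by closedness; a family
converging to `h` then also approximates `f i`. -/
theorem Approx.eventually_forall_mem_limSubgroup_exists {ε : ℝ} (hε : 0 < ε) :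
    ∀ᶠ i in l, ∀ h : D.limSubgroup hδ hδl G, ∃ g : G i,
      distPlan (π i) (Sum.inl g.1.1) (Sum.inr h.1.1) ≤ ENNReal.ofReal ε := by
  by_contra hcon
  rw [← Ultrafilter.eventually_not] at hcon
  have : ∀ i, ∃ h : D.limSubgroup hδ hδl G, (¬ ∀ h : D.limSubgroup hδ hδl G, ∃ g : G i,
      distPlan (π i) (Sum.inl g.1.1) (Sum.inr h.1.1) ≤ ENNReal.ofReal ε) →
      ¬ ∃ g : G i, distPlan (π i) (Sum.inl g.1.1) (Sum.inr h.1.1) ≤ ENNReal.ofReal ε := fun i => by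
    by_cases hi : ∀ h : D.limSubgroup hδ hδl G, ∃ g : G i,
      distPlan (π i) (Sum.inl g.1.1) (Sum.inr h.1.1) ≤ ENNReal.ofReal ε
    · exact ⟨1, fun h => (h hi).elim⟩
    · obtain ⟨g, hg⟩ := not_forall.1 hi
      exact ⟨g, fun _ => hg⟩
  choose f hf using this
  obtain ⟨h, hh⟩ := exists_eventually_kyFan_le hδ hδl fun i => (f i).1
  have hmem : h ∈ D.limSubgroup hδ hδl G := D.mem_limSubgroup_of_kyFan hδ hδl G h fun a ha => by
    obtain ⟨s, hs0, hs, hsa⟩ := ENNReal.lt_iff_exists_real_btwn.1 ha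
    obtain ⟨i, hi⟩ := (hh s (by simpa using hs)).exists
    exact ⟨(f i).1, (f i).2, hi.trans_lt hsa⟩
  obtain ⟨g, H⟩ := hmem
  obtain ⟨i, h1, h2, h3⟩ := (hcon.and ((D.eventually_distPlan_le hδ hδl H
    (show 0 < ε / 3 by positivity)).and (hh (ε / 3) (by positivity)))).exists
  refine hf i h1 ⟨g i, ?_⟩
  have hlt : ENNReal.ofReal (ε / 3) < ENNReal.ofReal (ε / 2) :=
    (ENNReal.ofReal_lt_ofReal_iff (by positivity)).2 (by linarith)
  refine (distPlan_lt_add_of_kyFan_lt (D.coupling i) h.1.continuous (f i).1.1.continuous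
    (h2.trans_lt hlt) (h3.trans_lt hlt)).trans_eq ?_
  rw [← ENNReal.ofReal_add (by positivity) (by positivity), add_halves]

theorem Approx.eventually_eqBox_le {ε : ℝ} (hε : 0 < ε) :
    ∀ᶠ i in l, eqBox (X i) (G i) Y (D.limSubgroup hδ hδl G) ≤ ENNReal.ofReal ε := by
  filter_upwards [D.eventually_forall_exists_mem_limSubgroup hδ hδl G hε,
    D.eventually_forall_mem_limSubgroup_exists hδ hδl G hε] with i h1 h2
  refine (iInf₂_le _ (D.coupling i)).trans (max_le (iSup_le fun g => ?_) (iSup_le fun h => ?_))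
  · obtain ⟨h, hh⟩ := h1 g
    exact (iInf_le _ h).trans hh
  · obtain ⟨g, hg⟩ := h2 h
    exact (iInf_le _ g).trans hg

end LimSubgroup

theorem prod_mem_couplings (X Y : MMSpace.{u}) : X.μ.prod Y.μ ∈ Couplings X Y := by
  simp [Couplings, Measure.map_fst_prod, Measure.map_snd_prod]

theorem exists_of_box_lt {X Y : MMSpace.{u}} {a : ℝ≥0∞} (h : box X Y < a) :
    ∃ π ∈ Couplings X Y, distPlan π (Sum.inl (id : X → X)) (Sum.inr (id : Y → Y)) < a := by
  simp only [box, eqBox, iInf_lt_iff] at h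
  obtain ⟨π, hπ, h⟩ := h
  refine ⟨π, hπ, ?_⟩
  have h1 := (le_iSup (fun g : (⊥ : Subgroup X.Aut) => ⨅ h : (⊥ : Subgroup Y.Aut),
    distPlan π (Sum.inl g.1.1) (Sum.inr h.1.1)) 1).trans_lt ((le_max_left _ _).trans_lt h)
  obtain ⟨k, hk⟩ := iInf_lt_iff.1 h1
  rwa [Subsingleton.elim k 1] at hk

theorem exists_approx {ι : Type*} {l : Ultrafilter ι} {δ : ι → ℝ}
    (hδ : ∀ i, 0 < δ i) (hδl : Tendsto δ l (𝓝 0)) {X : ι → MMSpace.{u}} {Y : MMSpace.{u}}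
    (h : Tendsto (fun i => box (X i) Y) l (𝓝 0)) : ∃ π S, Approx l X Y π S := by
  -- Only a default for the choice: the product coupling with the empty set.
  have hne : ∀ i, Nonempty (Couplings (X i) Y × {S : Set (X i × Y) // IsClosed S}) := fun i =>
    ⟨⟨_, prod_mem_couplings _ _⟩, ⟨∅, isClosed_empty⟩⟩
  obtain ⟨a, ha⟩ := exists_forall_eventually_of_slack hδ hδl
    (α := fun i => Couplings (X i) Y × {S : Set (X i × Y) // IsClosed S})
    (P := fun i r a => a.1.1 a.2.1ᶜ < ENNReal.ofReal r ∧ ∀ p ∈ a.2.1, ∀ q ∈ a.2.1,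
      |dist p.1 q.1 - dist p.2 q.2| < r)
    (fun i r s a hrs ⟨h1, h2⟩ => ⟨h1.trans_le (ENNReal.ofReal_le_ofReal hrs),
      fun p hp q hq => (h2 p hp q hq).trans_le hrs⟩) fun r hr => by
      filter_upwards [h.eventually (gt_mem_nhds (ENNReal.ofReal_pos.2 hr))] with i hi
      obtain ⟨π, hπ, hd⟩ := exists_of_box_lt hi
      have := isProbabilityMeasure_of_mem_couplings hπ
      obtain ⟨S, hS, hm, hd⟩ := exists_of_distPlan_lt hd
      exact ⟨⟨⟨π, hπ⟩, ⟨S, hS⟩⟩, hm, fun p hp q hq =>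
        (ENNReal.ofReal_lt_ofReal_iff hr).1 (hd p hp q hq)⟩
  refine ⟨fun i => (a i).1.1, fun i => (a i).2.1, fun i => (a i).1.2, fun i => (a i).2.2,
    fun r hr => ?_, fun r hr => (ha r hr).mono fun i hi => hi.2⟩
  obtain ⟨s, hs0, hs, hsr⟩ := ENNReal.lt_iff_exists_real_btwn.1 hr
  exact (ha s (by simpa using hs)).mono fun i hi => hi.1.trans hsr

end MMSpace

/-! ### Limits of pairs along ultrafilters -/

namespace EqMMSpace

theorem exists_tendsto_of_slack {ι : Type*} {l : Ultrafilter ι} {δ : ι → ℝ}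
    (hδ : ∀ i, 0 < δ i) (hδl : Tendsto δ l (𝓝 0)) {A : ι → EqMMSpace.{u}} {Y : MMSpace.{u}}
    (h : Tendsto (fun i => MMSpace.box (A i).space Y) l (𝓝 0)) :
    ∃ (H : Subgroup Y.Aut) (hH : Y.IsClosedSubgroup H),
      Tendsto (fun i => box (A i) ⟨Y, H, hH⟩) l (𝓝 0) := by
  obtain ⟨π, S, D⟩ := MMSpace.exists_approx hδ hδl h
  refine ⟨_, D.isClosedSubgroup_limSubgroup hδ hδl fun i => (A i).group, ?_⟩
  rw [ENNReal.tendsto_nhds_zero]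
  intro a ha
  obtain ⟨s, hs0, hs, hsa⟩ := ENNReal.lt_iff_exists_real_btwn.1 ha
  filter_upwards [D.eventually_eqBox_le hδ hδl (fun i => (A i).group)
    (ENNReal.ofReal_pos.1 hs)] with i hi
  exact hi.trans hsa.le

/-- Limits along arbitrary ultrafilters of pairs whose underlying spaces converge. -/
theorem exists_tendsto {ι : Type*} (l : Ultrafilter ι) {A : ι → EqMMSpace.{u}} {Y : MMSpace.{u}}
    (h : Tendsto (fun i => MMSpace.box (A i).space Y) l (𝓝 0)) :
    ∃ (H : Subgroup Y.Aut) (hH : Y.IsClosedSubgroup H),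
      Tendsto (fun i => box (A i) ⟨Y, H, hH⟩) l (𝓝 0) := by
  -- A general `l`, for example a principal one, admits no positive null family. The extra factor
  -- `ℕ` supplies one, and `L` still projects to `l`.
  let L : Ultrafilter (ι × ℕ) := Ultrafilter.of ((l : Filter ι) ×ˢ atTop)
  have hL : (L : Filter (ι × ℕ)) ≤ (l : Filter ι) ×ˢ atTop := Ultrafilter.of_le _
  have h1 : Tendsto Prod.fst (L : Filter (ι × ℕ)) l := tendsto_fst.mono_left hL
  have h2 : Tendsto Prod.snd (L : Filter (ι × ℕ)) atTop := tendsto_snd.mono_left hL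
  have hmap : L.map Prod.fst = l := Ultrafilter.coe_le_coe.1 h1
  obtain ⟨H, hH, hT⟩ := exists_tendsto_of_slack (l := L) (δ := fun i => 1 / ((i.2 : ℝ) + 1))
    (fun i => by positivity) (tendsto_one_div_add_atTop_nhds_zero_nat.comp h2)
    (A := fun i => A i.1) (h.comp h1)
  refine ⟨H, hH, ?_⟩
  rw [← hmap]
  exact hT

end EqMMSpace

/-! ### Comparison of the two box distances -/

namespace MMSpace

variable {X Y : MMSpace.{u}}

theorem distPlan_map_swap_le {π : Measure (X × Y)} [IsProbabilityMeasure π] (g : X → X)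
    (h : Y → Y) : distPlan (π.map Prod.swap) (Sum.inl h) (Sum.inr g)
      ≤ distPlan π (Sum.inl g) (Sum.inr h) := by
  refine le_of_forall_gt_imp_ge_of_dense fun a ha => ?_
  obtain ⟨S, hS, hm, hd⟩ := exists_of_distPlan_lt ha
  have := Measure.isProbabilityMeasure_map (μ := π) measurable_swap.aemeasurable
  refine distPlan_le (hS.preimage continuous_swap) ?_ fun p hp q hq => ?_
  · rw [Measure.map_apply measurable_swap
      (hS.preimage continuous_swap).isOpen_compl.measurableSet]
    exact hm.le
  · refine le_trans (le_of_eq ?_) (hd _ hp _ hq).le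
    rw [abs_sub_comm]
    rfl

theorem map_swap_mem_couplings {π : Measure (X × Y)} (hπ : π ∈ Couplings X Y) :
    π.map Prod.swap ∈ Couplings Y X :=
  ⟨(Measure.map_map measurable_fst measurable_swap).trans hπ.2,
    (Measure.map_map measurable_snd measurable_swap).trans hπ.1⟩

theorem eqBox_comm_le (G : Subgroup X.Aut) (H : Subgroup Y.Aut) :
    eqBox Y H X G ≤ eqBox X G Y H := by
  refine le_iInf₂ fun π hπ => (iInf₂_le _ (map_swap_mem_couplings hπ)).trans ?_
  have := isProbabilityMeasure_of_mem_couplings hπ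
  refine max_le (le_max_of_le_right ?_) (le_max_of_le_left ?_)
  · exact iSup_mono fun h => iInf_mono fun g => distPlan_map_swap_le _ _
  · exact iSup_mono fun h => iInf_mono fun g => distPlan_map_swap_le _ _

theorem eqBox_comm (G : Subgroup X.Aut) (H : Subgroup Y.Aut) :
    eqBox X G Y H = eqBox Y H X G :=
  le_antisymm (eqBox_comm_le H G) (eqBox_comm_le G H)

/-- Taking `q = p` bounds the distance from `h p.2` to `p.2`, so replacing `h` by the identity at
most doubles the error. -/
theorem distPlan_id_le {π : Measure (X × Y)} [IsProbabilityMeasure π] (h : Y ≃ᵢ Y) :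
    distPlan π (Sum.inl id) (Sum.inr id) ≤ 2 * distPlan π (Sum.inl id) (Sum.inr h) := by
  rw [mul_comm, ← ENNReal.div_le_iff_le_mul (Or.inl two_ne_zero) (Or.inl ENNReal.ofNat_ne_top)]
  refine le_of_forall_gt_imp_ge_of_dense fun a ha => ENNReal.div_le_of_le_mul' ?_
  obtain ⟨S, hS, hm, hd⟩ := exists_of_distPlan_lt ha
  refine distPlan_le hS (hm.le.trans (le_mul_of_one_le_left' one_le_two)) fun p hp q hq => ?_
  rw [two_mul]
  refine le_trans ?_ (add_le_add (hd p hp q hq).le (hd p hp p hp).le)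
  rw [← ENNReal.ofReal_add (abs_nonneg _) (abs_nonneg _)]
  apply ENNReal.ofReal_le_ofReal
  simp only [displacement, id, dist_self, zero_sub, abs_neg, abs_dist]
  have h1 := abs_dist_sub_le (h p.2) p.2 q.2
  have h2 := abs_sub_le (dist p.1 q.1) (dist (h p.2) q.2) (dist p.2 q.2)
  linarith

theorem box_le_two_mul_eqBox (G : Subgroup X.Aut) (H : Subgroup Y.Aut) :
    box X Y ≤ 2 * eqBox X G Y H := by
  rw [mul_comm, ← ENNReal.div_le_iff_le_mul (Or.inl two_ne_zero) (Or.inl ENNReal.ofNat_ne_top)]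
  refine le_iInf₂ fun π hπ => ENNReal.div_le_of_le_mul' ?_
  have := isProbabilityMeasure_of_mem_couplings hπ
  refine (iInf₂_le π hπ).trans (le_trans (b := distPlan π (Sum.inl id) (Sum.inr id)) ?_ ?_)
  · refine max_le (iSup_le fun g => (iInf_le _ 1).trans ?_) (iSup_le fun h => (iInf_le _ 1).trans ?_)
    · rw [Subsingleton.elim g 1]
      rfl
    · rw [Subsingleton.elim h 1]
      rfl
  · rw [mul_comm, ← ENNReal.div_le_iff_le_mul (Or.inl two_ne_zero) (Or.inl ENNReal.ofNat_ne_top)]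
    refine le_max_of_le_left ((le_iInf fun h => ENNReal.div_le_of_le_mul' ?_).trans
      (le_iSup (fun g : G => ⨅ h : H, distPlan π (Sum.inl g.1.1) (Sum.inr h.1.1)) 1))
    exact distPlan_id_le h.1.1

theorem Isomorphic.box_eq_zero (h : Isomorphic X Y) : box X Y = 0 := by
  obtain ⟨f, hf⟩ := h
  have hc : IsClosed {p : X × Y | p.2 = f p.1} :=
    isClosed_eq continuous_snd (f.continuous.comp continuous_fst)
  have hπ := map_prodMk_mem_couplings hf
  have := isProbabilityMeasure_of_mem_couplings hπ
  refine le_antisymm ((iInf₂_le _ hπ).trans ?_) bot_le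
  have key : distPlan (X.μ.map fun x => (x, f x)) (Sum.inl (id : X → X))
      (Sum.inr (id : Y → Y)) ≤ 0 := by
    refine distPlan_le hc ?_ fun p hp q hq => ?_
    · rw [Measure.map_apply (measurable_id'.prodMk f.continuous.measurable)
        hc.measurableSet.compl]
      simp [Set.preimage]
    · rw [Set.mem_ofPred] at hp hq
      simp [displacement, hp, hq, f.dist_eq]
  refine max_le (iSup_le fun g => (iInf_le _ 1).trans ?_) (iSup_le fun h => (iInf_le _ 1).trans ?_)
  · rw [Subsingleton.elim g 1]
    exact key
  · rw [Subsingleton.elim h 1]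
    exact key

end MMSpace

/-! ### Properness of the projection -/

namespace EqMMClass

theorem box_comm (a b : EqMMClass.{u}) : box a b = box b a := by
  induction a using Quotient.inductionOn
  induction b using Quotient.inductionOn
  exact MMSpace.eqBox_comm _ _

theorem box_proj_le (a b : EqMMClass.{u}) : MMClass.box a.proj b.proj ≤ 2 * box a b := by
  induction a using Quotient.inductionOn
  induction b using Quotient.inductionOn
  exact MMSpace.box_le_two_mul_eqBox _ _

theorem continuous_proj : Continuous (proj : EqMMClass.{u} → MMClass.{u}) where
  isOpen_preimage U hU a ha := by
    obtain ⟨ε, hε, h⟩ := hU _ ha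
    refine ⟨ε / 2, ENNReal.half_pos hε.ne', fun b hb => h _ ((box_proj_le a b).trans_lt ?_)⟩
    rw [mul_comm]
    exact (ENNReal.lt_div_iff_mul_lt (Or.inl two_ne_zero) (Or.inl ENNReal.ofNat_ne_top)).1 hb

theorem le_nhds_of_tendsto_box {l : Filter EqMMClass.{u}} {b : EqMMClass.{u}}
    (h : Tendsto (fun a => box a b) l (𝓝 0)) : l ≤ 𝓝 b := by
  intro s hs
  obtain ⟨U, hUs, hU, hb⟩ := mem_nhds_iff.1 hs
  obtain ⟨ε, hε, hball⟩ := hU b hb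
  filter_upwards [h.eventually (gt_mem_nhds hε)] with a ha
  exact hUs (hball a (by rwa [box_comm]))

/-- Limits along arbitrary ultrafilters of classes of pairs whose projections converge. -/
theorem exists_tendsto {ι : Type*} (l : Ultrafilter ι) {a : ι → EqMMClass.{u}} {y : MMClass.{u}}
    (h : Tendsto (fun i => MMClass.box (a i).proj y) l (𝓝 0)) :
    ∃ b, b.proj = y ∧ Tendsto (fun i => box (a i) b) l (𝓝 0) := by
  obtain ⟨Y, rfl⟩ := Quotient.exists_rep y
  choose A hA using fun i => Quotient.exists_rep (a i)
  obtain rfl : (fun i => ⟦A i⟧) = a := funext hA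
  obtain ⟨H, hH, hT⟩ := EqMMSpace.exists_tendsto l (A := A) h
  exact ⟨⟦⟨Y, H, hH⟩⟧, rfl, hT⟩

theorem isCompact_preimage_proj (y : MMClass.{u}) :
    IsCompact ((proj : EqMMClass.{u} → MMClass.{u}) ⁻¹' {y}) := by
  refine isCompact_iff_ultrafilter_le_nhds'.2 fun l hl => ?_
  have h0 : ∀ᶠ a in l, MMClass.box (proj a) y = 0 := by
    filter_upwards [hl] with a ha
    rw [Set.mem_preimage, Set.mem_singleton_iff] at ha
    rw [ha]
    induction y using Quotient.inductionOn with | _ Y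
    exact MMSpace.Isomorphic.box_eq_zero (Setoid.refl Y)
  obtain ⟨b, hb, hT⟩ := exists_tendsto l (a := id)
    (tendsto_const_nhds.congr' (h0.mono fun a ha => ha.symm))
  exact ⟨b, hb, le_nhds_of_tendsto_box hT⟩

/-- If the complement of the image is not open at `y`, some sequence in `C` has projections
approaching `y`. Its ultrafilter limit over `y` lies in `C`. -/
theorem isClosedMap_proj : IsClosedMap (proj : EqMMClass.{u} → MMClass.{u}) := by
  intro C hC
  refine ⟨fun y hy => ?_⟩
  by_contra hcon
  push Not at hcon
  have : ∀ n : ℕ, ∃ a ∈ C, MMClass.box (proj a) y < 1 / ((n : ℝ≥0∞) + 1) := fun n => by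
    obtain ⟨_, hlt, hmem⟩ := hcon (1 / ((n : ℝ≥0∞) + 1))
      (ENNReal.div_pos one_ne_zero (by finiteness))
    obtain ⟨a, ha, rfl⟩ := Set.notMem_compl_iff.1 hmem
    refine ⟨a, ha, lt_of_eq_of_lt ?_ hlt⟩
    induction a using Quotient.inductionOn
    induction y using Quotient.inductionOn
    exact MMSpace.eqBox_comm _ _
  choose a haC ha using this
  have hlim : Tendsto (fun n => MMClass.box (proj (a n)) y) (hyperfilter ℕ) (𝓝 0) := by
    refine Tendsto.mono_left ?_ Nat.hyperfilter_le_atTop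
    refine tendsto_of_tendsto_of_tendsto_of_le_of_le tendsto_const_nhds
      (h := fun n : ℕ => 1 / ((n : ℝ≥0∞) + 1)) ?_ (fun _ => zero_le) fun n => (ha n).le
    simpa using (tendsto_add_atTop_iff_nat 1).2 ENNReal.tendsto_inv_nat_nhds_zero
  obtain ⟨b, rfl, hT⟩ := exists_tendsto _ hlim
  refine hy ⟨b, ?_, rfl⟩
  have hle : map a (hyperfilter ℕ : Filter ℕ) ≤ 𝓝 b := le_nhds_of_tendsto_box hT
  exact hC.mem_of_tendsto hle (Eventually.of_forall haC)

theorem isProperMap_proj : IsProperMap (proj : EqMMClass.{u} → MMClass.{u}) :=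
  isProperMap_iff_isClosedMap_and_compact_fibers.2
    ⟨continuous_proj, isClosedMap_proj, isCompact_preimage_proj⟩

end EqMMClass

theorem mainTheorem5 :
    IsProperMap (EqMMClass.proj : EqMMClass.{u} → MMClass.{u}) ∧
    ∀ (A : ℕ → EqMMSpace.{u}) (Y : MMSpace.{u}),
      Tendsto (fun n => MMSpace.box (A n).space Y) atTop (𝓝 0) →
      ∃ (H : Subgroup Y.Aut) (hH : Y.IsClosedSubgroup H) (φ : ℕ → ℕ), StrictMono φ ∧
        Tendsto (fun k => EqMMSpace.box (A (φ k)) ⟨Y, H, hH⟩) atTop (𝓝 0) := by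
  refine ⟨EqMMClass.isProperMap_proj, fun A Y h => ?_⟩
  obtain ⟨H, hH, hT⟩ := EqMMSpace.exists_tendsto (hyperfilter ℕ)
    (h.mono_left Nat.hyperfilter_le_atTop)
  -- The ultrafilter limit is a cluster point of the sequence of distances, hence a limit along a
  -- subsequence.
  have hcl : MapClusterPt 0 atTop fun n => EqMMSpace.box (A n) ⟨Y, H, hH⟩ :=
    (Tendsto.mapClusterPt hT).mono (map_mono Nat.hyperfilter_le_atTop)
  obtain ⟨φ, hφ, hφT⟩ := hcl.tendsto_subseq
  exact ⟨H, hH, φ, hφ, hφT⟩
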